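/- Let $X$ be a (reduced) complex analytic variety of dimension $n$: a second countable Hausdorff space with a maximal atlas of charts $F:A\to W$, homeomorphisms from open sets $A\subseteq X$ onto holomorphic subvarieties $W$ of open sets $U\subseteq\mathbb C^{m}$ ($m$ depending on the chart), with biholomorphic transition maps, whose regular part $X'$ (the set of points near which $X$ is a complex manifold) is a complex manifold of dimension $n$. Let $Z\subseteq X$ be the closure of an open subset of $X$ (for instance, of a non-empty open set whose closure is a polyhedron of $X$, i.e. a subcomplex of a triangulation of $X$), and let $\mathbb K$ be $\mathbb R$ or $\mathbb C$. For $S=X$ or $S=Z$ and $p\ge 0$ let $\Gamma^p_{ext}(S)$ be the $\mathbb K$-vector space of extendable sections over $S\cap X'$ of the bundle of $\mathbb K$-valued real-alternating $p$-covectors $\Lambda^pT^*X'\otimes\mathbb K$, that is, of the sections $\omega$ such that around every point $x\in S$, singular or not, there are a chart $F:A\to W\subseteq U$ with $x\in A$ and a smooth $\mathbb K$-valued $p$-form $\tilde\omega$ on a neighbourhood of $F(x)$ in $\mathbb C^m$ with $\omega=F^*\tilde\omega$ at all points of $S\cap X'$ near $x$. Put $\Gamma^{-1}_{ext}(S)=0$.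 The exterior differential $d:\Gamma^p_{ext}(S)\to\Gamma^{p+1}_{ext}(S)$ is defined by $d\omega=F^*(d\tilde\omega)$ locally, and $\omega\mapsto\omega|_Z$ denotes the restriction $\Gamma^p_{ext}(X)\to\Gamma^p_{ext}(Z)$. Let $\Gamma^p_{ext}(X)_Z=\{\omega\in\Gamma^p_{ext}(X):\omega|_Z=0\}$, a complex under $d$, and let $H^p_{ext}(X)_Z$ be its $p$-th cohomology. Let $H^p_{ext}(X,Z)$ be the $p$-th cohomology of the complex $\Gamma^p_{ext}(X)\oplus\Gamma^{p-1}_{ext}(Z)$ with the differential $(\varkappa,\upsilon)\mapsto(d\varkappa,\ \varkappa|_Z-d\upsilon)$. Then for every $p\ge 0$ the homomorphism $$A^p:H^p_{ext}(X)_Z\to H^p_{ext}(X,Z),\qquad [\omega]\mapsto[(\omega,0)],$$ is an isomorphism. -/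

import Mathlib

open Set Filter Topology



noncomputable section

namespace ExtForm

universe u

/-! ### Complex analytic varieties -/

/-- A map between complex number spaces is holomorphic on an arbitrary subset `S` if near every
point of `S` it is the restriction to `S` of a holomorphic map defined near that point. -/
def HolomorphicOnSet {m k : ℕ} (f : (Fin m → ℂ) → (Fin k → ℂ)) (S : Set (Fin m → ℂ)) : Prop :=
  ∀ z ∈ S, ∃ G : (Fin m → ℂ) → (Fin k → ℂ), AnalyticAt ℂ G z ∧ ∀ᶠ w in 𝓝[S] z, f w = G w

/-- A chart of a complex analytic variety: a homeomorphism `F : A → W` from an open subset `A` of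
`X` (the source) onto a holomorphic subvariety `W` (the target) of an open set `U ⊆ ℂ^dim`. -/
structure AnalyticChart (X : Type u) [TopologicalSpace X] where
  dim : ℕ
  F : PartialEquiv X (Fin dim → ℂ)
  U : Set (Fin dim → ℂ)
  isOpen_source : IsOpen F.source
  continuousOn_toFun : ContinuousOn F F.source
  continuousOn_invFun : ContinuousOn F.symm F.target
  isOpen_U : IsOpen U
  target_subset : F.target ⊆ U
  /-- Near each point of `U` the target is the set of common zeros of finitely many holomorphic
  functions. -/
  analytic : ∀ z ∈ U, ∃ (k : ℕ) (f : (Fin dim → ℂ) → (Fin k → ℂ)),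
    AnalyticAt ℂ f z ∧ ∀ᶠ w in 𝓝 z, (w ∈ F.target ↔ f w = 0)

/-- The transition map `F' ∘ F⁻¹ : F(A ∩ A') → F'(A ∩ A')` is holomorphic. -/
def AnalyticChart.CompatibleTo {X : Type u} [TopologicalSpace X] (c c' : AnalyticChart X) : Prop :=
  HolomorphicOnSet (c'.F ∘ c.F.symm) (c.F.target ∩ c.F.symm ⁻¹' c'.F.source)

/-- The structure of a (reduced) complex analytic variety of dimension `n` on a topological space
`X` (to be assumed Hausdorff and second countable), given by its maximal atlas: an open covering by
charts, any two of which are related by biholomorphic transition maps. The charts whose target is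
open in `ℂ^dim` are the holomorphic charts of the regular part; they are of dimension `n`. -/
structure AnalyticVariety (n : ℕ) (X : Type u) [TopologicalSpace X] where
  atlas : Set (AnalyticChart X)
  covers : ∀ x : X, ∃ c ∈ atlas, x ∈ c.F.source
  compatible : ∀ c ∈ atlas, ∀ c' ∈ atlas, c.CompatibleTo c'
  maximal : ∀ c : AnalyticChart X,
    (∀ c' ∈ atlas, c.CompatibleTo c' ∧ c'.CompatibleTo c) → c ∈ atlas
  dim_regular : ∀ c ∈ atlas, IsOpen c.F.target → c.F.target.Nonempty → c.dim = n

variable {n : ℕ} {X : Type u} [TopologicalSpace X]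

namespace AnalyticVariety

/-- A holomorphic chart of the complex manifold `X'`, the regular part of `X`. -/
def RegularChart (V : AnalyticVariety n X) : Type u :=
  {c : AnalyticChart X // c ∈ V.atlas ∧ IsOpen c.F.target}

/-- The regular part `X'` of `X`: the points near which `X` is a complex manifold. -/
def regularPart (V : AnalyticVariety n X) : Set X := ⋃ φ : V.RegularChart, φ.1.F.source

end AnalyticVariety

/-! ### Differential forms -/

/-- Alternating `ℝ`-multilinear `p`-forms on `ℂ^m` with values in `𝕜` (which is `ℝ` or `ℂ`). -/
abbrev Alt (𝕜 : Type) [RCLike 𝕜] (m p : ℕ) : Type := (Fin m → ℂ) [⋀^Fin p]→L[ℝ] 𝕜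

variable {𝕜 : Type} [RCLike 𝕜]

/-- Pull-back at the point `z` along `f` of a `p`-covector at the point `f z`. -/
def pull {m k p : ℕ} (f : (Fin m → ℂ) → (Fin k → ℂ)) (z : Fin m → ℂ) (α : Alt 𝕜 k p) : Alt 𝕜 m p :=
  α.compContinuousLinearMap (fderiv ℝ f z)

/-- Families of `p`-covectors, one for each holomorphic chart `φ` of the regular part `X'` and each
point of `S ∩ X'` in the source of `φ`. -/
abbrev Family (V : AnalyticVariety n X) (𝕜 : Type) [RCLike 𝕜] (p : ℕ) (S : Set X) : Type u :=
  (φ : V.RegularChart) → {y : X // y ∈ φ.1.F.source ∧ y ∈ S} → Alt 𝕜 φ.1.dim p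

/-- A family is a section over `S ∩ X'` of the bundle of `p`-covectors `Λ^p T^* X'` if its members
transform into each other by pull-back along the transition maps. -/
def IsSection {V : AnalyticVariety n X} {p : ℕ} {S : Set X} (ω : Family V 𝕜 p S) : Prop :=
  ∀ (φ ψ : V.RegularChart) (y : X) (hφ : y ∈ φ.1.F.source) (hψ : y ∈ ψ.1.F.source) (hS : y ∈ S),
    ω φ ⟨y, hφ, hS⟩ = pull (ψ.1.F ∘ φ.1.F.symm) (φ.1.F y) (ω ψ ⟨y, hψ, hS⟩)

/-- `θ` is a differential form on a neighbourhood of `c(x)` in the number space of the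
chart `c` which is smooth there and extends `ω` on `S` around `x`: at the points of `S ∩ X'` near
`x` the covector `ω` is the pull-back of `θ` along `c`. -/
def ExtendsAt {V : AnalyticVariety n X} {p : ℕ} {S : Set X} (c : AnalyticChart X)
    (θ : (Fin c.dim → ℂ) → Alt 𝕜 c.dim p) (x : X) (ω : Family V 𝕜 p S) : Prop :=
  (∀ᶠ w in 𝓝 (c.F x), ContDiffAt ℝ ((⊤ : ℕ∞) : WithTop ℕ∞) θ w) ∧
    ∀ᶠ y in 𝓝 x, ∀ (φ : V.RegularChart) (h : y ∈ φ.1.F.source ∧ y ∈ S),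
      ω φ ⟨y, h⟩ = pull (c.F ∘ φ.1.F.symm) (φ.1.F y) (θ (c.F y))

/-- Extendability: around every point of `S`, singular or not, there is a chart of the variety
in which the family is the restriction of a smooth differential form of the number space. -/
def IsExtendable {V : AnalyticVariety n X} {p : ℕ} {S : Set X} (ω : Family V 𝕜 p S) : Prop :=
  ∀ x ∈ S, ∃ c ∈ V.atlas, x ∈ c.F.source ∧ ∃ θ, ExtendsAt c θ x ω


/-! ### Smoothness of pull-backs -/

section helpers
variable {E F G : Type*} [NormedAddCommGroup E] [NormedSpace ℝ E]
  [NormedAddCommGroup F] [NormedSpace ℝ F] [NormedAddCommGroup G] [NormedSpace ℝ G]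

/-- Alternatization of multilinear maps as a continuous linear map. -/
def altCLM (p : ℕ) : ContinuousMultilinearMap ℝ (fun _ : Fin p => E) G →L[ℝ] E [⋀^Fin p]→L[ℝ] G :=
  LinearMap.mkContinuous
    { toFun := fun f => ContinuousMultilinearMap.alternatization f
      map_add' := fun f g => map_add _ f g
      map_smul' := fun r f => by
        ext v
        simp only [ContinuousMultilinearMap.alternatization_apply_apply,
          smul_apply, ContinuousAlternatingMap.smul_apply,
          RingHom.id_apply, Finset.smul_sum]
        exact Finset.sum_congr rfl fun σ _ => smul_comm _ _ _ }
    (Fintype.card (Equiv.Perm (Fin p))) (by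
      intro f
      refine ContinuousAlternatingMap.opNorm_le_bound _ (by positivity) fun v => ?_
      simp only [LinearMap.coe_mk, AddHom.coe_mk,
        ContinuousMultilinearMap.alternatization_apply_apply]
      refine (norm_sum_le _ _).trans ?_
      calc _ ≤ ∑ σ : Equiv.Perm (Fin p), ‖f‖ * ∏ i, ‖v i‖ := by
            refine Finset.sum_le_sum fun σ _ => ?_
            have h1 : ‖Equiv.Perm.sign σ • f (v ∘ σ)‖ = ‖f (v ∘ σ)‖ := by
              rcases Int.units_eq_one_or (Equiv.Perm.sign σ) with h | h <;> simp [h]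
            rw [h1]
            refine (f.le_opNorm _).trans_eq ?_
            congr 1
            exact Equiv.prod_comp σ (fun i => ‖v i‖)
        _ = _ := by simp [mul_assoc])

theorem contDiffAt_comp {p : ℕ} {H : Type*} [NormedAddCommGroup H] [NormedSpace ℝ H] {r : WithTop ℕ∞}
    {θ : H → F [⋀^Fin p]→L[ℝ] G} {A : H → E →L[ℝ] F} {x : H}
    (hθ : ContDiffAt ℝ r θ x) (hA : ContDiffAt ℝ r A x) :
    ContDiffAt ℝ r (fun y => (θ y).compContinuousLinearMap (A y)) x := by
  have key : (fun y => (θ y).compContinuousLinearMap (A y)) = fun y =>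
      ((Fintype.card (Equiv.Perm (Fin p)) : ℝ)⁻¹ • altCLM p)
        (ContinuousMultilinearMap.compContinuousLinearMapContinuousMultilinear ℝ
          (fun _ : Fin p => E) (fun _ : Fin p => F) G (fun _ => A y)
          (ContinuousAlternatingMap.toContinuousMultilinearMapCLM ℝ (θ y))) := by
    funext y
    ext v
    have : ∀ σ : Equiv.Perm (Fin p), Equiv.Perm.sign σ • (θ y) (fun i => A y (v (σ i)))
        = (θ y) (fun i => A y (v i)) := by
      intro σ
      have := (θ y).toAlternatingMap.map_perm (fun i => A y (v i)) σ
      simp only [ContinuousAlternatingMap.coe_toAlternatingMap, Function.comp_def] at this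
      rw [this, smul_smul]
      rcases Int.units_eq_one_or (Equiv.Perm.sign σ) with h | h <;> simp [h]
    have hc : (Fintype.card (Equiv.Perm (Fin p)) : ℝ) ≠ 0 := by positivity
    simp [altCLM, ContinuousMultilinearMap.alternatization_apply_apply, Function.comp_def, this]
    rw [← Nat.cast_smul_eq_nsmul ℝ, smul_smul, inv_mul_cancel₀ hc, one_smul]
  rw [key]
  refine (ContinuousLinearMap.contDiff _).contDiffAt.comp x ?_
  refine ContDiffAt.clm_apply ?_ ?_
  · refine (ContinuousMultilinearMap.contDiff _).contDiffAt.comp x ?_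
    exact contDiffAt_pi.2 fun _ => hA
  · exact (ContinuousLinearMap.contDiff _).contDiffAt.comp x hθ
end helpers

section charts

variable {V : AnalyticVariety n X} {p : ℕ} {S : Set X}

theorem AnalyticChart.source_mem (c : AnalyticChart X) {x : X} (h : x ∈ c.F.source) :
    c.F.source ∈ 𝓝 x := c.isOpen_source.mem_nhds h

theorem AnalyticChart.continuousAt (c : AnalyticChart X) {x : X} (h : x ∈ c.F.source) :
    ContinuousAt c.F x := c.continuousOn_toFun.continuousAt (c.source_mem h)

theorem AnalyticVariety.RegularChart.symm_tendsto (φ : V.RegularChart) {y : X}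
    (h : y ∈ φ.1.F.source) : Tendsto φ.1.F.symm (𝓝 (φ.1.F y)) (𝓝 y) := by
  have := φ.1.continuousOn_invFun.continuousAt (φ.2.2.mem_nhds (φ.1.F.map_source h))
  simpa [ContinuousAt, φ.1.F.left_inv h] using this

theorem AnalyticVariety.RegularChart.analyticAt (φ : V.RegularChart) {c : AnalyticChart X}
    (hc : c ∈ V.atlas) {y : X} (h : y ∈ φ.1.F.source) (hy : y ∈ c.F.source) :
    AnalyticAt ℂ (c.F ∘ φ.1.F.symm) (φ.1.F y) := by
  obtain ⟨G, hG, hGe⟩ := V.compatible φ.1 φ.2.1 c hc (φ.1.F y)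
    ⟨φ.1.F.map_source h, by simpa [φ.1.F.left_inv h] using hy⟩
  have hm : φ.1.F.target ∩ φ.1.F.symm ⁻¹' c.F.source ∈ 𝓝 (φ.1.F y) :=
    inter_mem (φ.2.2.mem_nhds (φ.1.F.map_source h)) (φ.symm_tendsto h (c.source_mem hy))
  rw [nhdsWithin_eq_nhds.2 hm] at hGe
  exact hG.congr (hGe.mono fun _ h => h.symm)

theorem AnalyticVariety.RegularChart.contDiffAt (φ : V.RegularChart) {c : AnalyticChart X}
    (hc : c ∈ V.atlas) {y : X} (h : y ∈ φ.1.F.source) (hy : y ∈ c.F.source) :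
    ContDiffAt ℝ ⊤ (c.F ∘ φ.1.F.symm) (φ.1.F y) :=
  ((φ.analyticAt hc h hy).restrictScalars (𝕜 := ℝ)).contDiffAt

theorem pull_pull {m k l : ℕ} {f : (Fin m → ℂ) → (Fin k → ℂ)} {g : (Fin k → ℂ) → (Fin l → ℂ)}
    {z : Fin m → ℂ} (hg : DifferentiableAt ℝ g (f z)) (hf : DifferentiableAt ℝ f z)
    (α : Alt 𝕜 l p) : pull f z (pull g (f z) α) = pull (g ∘ f) z α := by
  have e : fderiv ℝ (g ∘ f) z = (fderiv ℝ g (f z)).comp (fderiv ℝ f z) := fderiv_comp z hg hf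
  ext v
  simp [pull, e]
  rfl

theorem pull_congr {m k : ℕ} {f g : (Fin m → ℂ) → (Fin k → ℂ)} {z : Fin m → ℂ}
    (h : f =ᶠ[𝓝 z] g) (α : Alt 𝕜 k p) : pull f z α = pull g z α := by
  simp [pull, h.fderiv_eq]

theorem AnalyticVariety.RegularChart.pull_self (φ : V.RegularChart) {y : X}
    (h : y ∈ φ.1.F.source) (α : Alt 𝕜 φ.1.dim p) :
    pull (φ.1.F ∘ φ.1.F.symm) (φ.1.F y) α = α := by
  have : φ.1.F ∘ φ.1.F.symm =ᶠ[𝓝 (φ.1.F y)] id := by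
    filter_upwards [φ.2.2.mem_nhds (φ.1.F.map_source h)] with z hz
    simp [φ.1.F.right_inv hz]
  rw [pull_congr this]
  ext v
  simp [pull]

theorem contDiffAt_pull {m k : ℕ} {G : (Fin m → ℂ) → (Fin k → ℂ)}
    {θ : (Fin k → ℂ) → Alt 𝕜 k p} {z : Fin m → ℂ} (hG : ContDiffAt ℝ ⊤ G z)
    (hθ : ContDiffAt ℝ ((⊤ : ℕ∞) : WithTop ℕ∞) θ (G z)) :
    ContDiffAt ℝ ((⊤ : ℕ∞) : WithTop ℕ∞) (fun w => pull G w (θ (G w))) z := by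
  have h1 : ContDiffAt ℝ ((⊤ : ℕ∞) : WithTop ℕ∞) G z := hG.of_le le_top
  refine contDiffAt_comp (hθ.comp z h1) ?_
  exact hG.fderiv_right (m := ((⊤ : ℕ∞) : WithTop ℕ∞)) le_top

theorem ExtendsAt.eventually {c : AnalyticChart X} {θ : (Fin c.dim → ℂ) → Alt 𝕜 c.dim p} {x : X}
    {ω : Family V 𝕜 p S} (h : ExtendsAt c θ x ω) (hx : x ∈ c.F.source) :
    ∀ᶠ y in 𝓝 x, ExtendsAt c θ y ω := by
  have h1 := (c.continuousAt hx).eventually (eventually_eventually_nhds.2 h.1)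
  filter_upwards [h1, eventually_eventually_nhds.2 h.2] with y h1 h2
  exact ⟨h1, h2⟩

/-- Extensions can be moved from one chart to another. -/
theorem ExtendsAt.transfer {c c' : AnalyticChart X} (hc' : c' ∈ V.atlas)
    {θ : (Fin c.dim → ℂ) → Alt 𝕜 c.dim p} {x : X} {ω : Family V 𝕜 p S}
    (h : ExtendsAt c θ x ω) (hx : x ∈ c.F.source) (hx' : x ∈ c'.F.source)
    {G : (Fin c'.dim → ℂ) → (Fin c.dim → ℂ)} (hG : AnalyticAt ℂ G (c'.F x))
    (hGe : ∀ᶠ w in 𝓝[c'.F.target ∩ c'.F.symm ⁻¹' c.F.source] (c'.F x), (c.F ∘ c'.F.symm) w = G w) :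
    ExtendsAt c' (fun w => pull G w (θ (G w))) x ω := by
  have hGe' : ∀ᶠ y in 𝓝 x, y ∈ c.F.source ∧ y ∈ c'.F.source ∧ c.F y = G (c'.F y) := by
    have h1 := (c'.continuousAt hx').eventually (eventually_nhdsWithin_iff.1 hGe)
    filter_upwards [h1, c.source_mem hx, c'.source_mem hx'] with y h1 h2 h3
    refine ⟨h2, h3, ?_⟩
    have := h1 ⟨c'.F.map_source h3, by simpa [c'.F.left_inv h3] using h2⟩
    simpa [c'.F.left_inv h3] using this
  have hG0 : c.F x = G (c'.F x) := hGe'.self_of_nhds.2.2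
  have hGs : ∀ᶠ w in 𝓝 (c'.F x), ContDiffAt ℝ ⊤ G w :=
    hG.eventually_analyticAt.mono fun w hw => (hw.restrictScalars (𝕜 := ℝ)).contDiffAt
  refine ⟨?_, ?_⟩
  · have h1 := h.1
    rw [hG0] at h1
    filter_upwards [hGs, hG.continuousAt.eventually h1] with w h2 h3
    exact contDiffAt_pull h2 h3
  · filter_upwards [h.2, (c'.continuousAt hx').eventually hGs,
      eventually_eventually_nhds.2 hGe'] with y h1 h2 h3 φ hφ
    rw [h1 φ hφ]
    obtain ⟨ha, hb, hcG⟩ := h3.self_of_nhds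
    have e : (c'.F ∘ φ.1.F.symm) (φ.1.F y) = c'.F y := by simp [φ.1.F.left_inv hφ.1]
    have h4 : c.F ∘ φ.1.F.symm =ᶠ[𝓝 (φ.1.F y)] G ∘ (c'.F ∘ φ.1.F.symm) := by
      filter_upwards [(φ.symm_tendsto hφ.1).eventually h3] with z hz
      exact hz.2.2
    have key := pull_pull (𝕜 := 𝕜) (p := p) (f := c'.F ∘ φ.1.F.symm) (g := G) (z := φ.1.F y)
      (by rw [e]; exact h2.differentiableAt (by simp))
      ((φ.contDiffAt hc' hφ.1 hb).differentiableAt (by simp)) (θ (c.F y))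
    rw [pull_congr h4, ← key, e, hcG]

theorem ExtendsAt.exists_transfer {c c' : AnalyticChart X} (hc : c ∈ V.atlas) (hc' : c' ∈ V.atlas)
    {θ : (Fin c.dim → ℂ) → Alt 𝕜 c.dim p} {x : X} {ω : Family V 𝕜 p S}
    (h : ExtendsAt c θ x ω) (hx : x ∈ c.F.source) (hx' : x ∈ c'.F.source) :
    ∃ θ', ExtendsAt c' θ' x ω := by
  obtain ⟨G, hG, hGe⟩ := V.compatible c' hc' c hc (c'.F x)
    ⟨c'.F.map_source hx', by simpa [c'.F.left_inv hx'] using hx⟩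
  exact ⟨_, h.transfer hc' hx hx' hG hGe⟩

theorem IsExtendable.exists_extendsAt {ω : Family V 𝕜 p S} (h : IsExtendable ω)
    {c : AnalyticChart X} (hc : c ∈ V.atlas) {x : X} (hx : x ∈ c.F.source) (hxS : x ∈ S) :
    ∃ θ, ExtendsAt c θ x ω := by
  obtain ⟨c', hc', hx', θ, hθ⟩ := h x hxS
  exact hθ.exists_transfer hc' hc hx' hx

theorem ExtendsAt.add {c : AnalyticChart X} {θ θ' : (Fin c.dim → ℂ) → Alt 𝕜 c.dim p} {x : X}
    {ω ω' : Family V 𝕜 p S} (h : ExtendsAt c θ x ω) (h' : ExtendsAt c θ' x ω') :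
    ExtendsAt c (θ + θ') x (ω + ω') := by
  refine ⟨?_, ?_⟩
  · filter_upwards [h.1, h'.1] with w h1 h2 using h1.add h2
  · filter_upwards [h.2, h'.2] with y h1 h2 φ hy
    simp only [Pi.add_apply, h1 φ hy, h2 φ hy]
    ext v
    simp [pull]

theorem ExtendsAt.smul {c : AnalyticChart X} {θ : (Fin c.dim → ℂ) → Alt 𝕜 c.dim p} {x : X}
    {ω : Family V 𝕜 p S} (r : 𝕜) (h : ExtendsAt c θ x ω) :
    ExtendsAt c (r • θ) x (r • ω) := by
  refine ⟨?_, ?_⟩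
  · filter_upwards [h.1] with w h1 using h1.const_smul r
  · filter_upwards [h.2] with y h1 φ hy
    simp only [Pi.smul_apply, h1 φ hy]
    ext v
    simp [pull]

end charts

/-- The extendable sections over `S ∩ X'` of `Λ^p T^* X'` form a vector space. -/
def extSubmodule (V : AnalyticVariety n X) (𝕜 : Type) [RCLike 𝕜] (p : ℕ) (S : Set X) :
    Submodule 𝕜 (Family V 𝕜 p S) where
  carrier := {ω | IsSection ω ∧ IsExtendable ω}
  add_mem' := by
    rintro ω ω' ⟨h1, h2⟩ ⟨h1', h2'⟩
    refine ⟨fun φ ψ y hφ hψ hS => ?_, fun x hx => ?_⟩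
    · simp only [Pi.add_apply, h1 φ ψ y hφ hψ hS, h1' φ ψ y hφ hψ hS]
      ext v
      simp [pull]
    · obtain ⟨c, hc, hxc, θ, hθ⟩ := h2 x hx
      obtain ⟨θ', hθ'⟩ := h2'.exists_extendsAt hc hxc hx
      exact ⟨c, hc, hxc, _, hθ.add hθ'⟩
  zero_mem' := by
    refine ⟨fun φ ψ y hφ hψ hS => ?_, fun x hx => ?_⟩
    · ext v
      simp [pull]
    · obtain ⟨c, hc, hxc⟩ := V.covers x
      refine ⟨c, hc, hxc, 0, Eventually.of_forall fun w => contDiffAt_const, ?_⟩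
      refine Eventually.of_forall fun y φ hy => ?_
      ext v
      simp [pull]
  smul_mem' := by
    rintro r ω ⟨h1, h2⟩
    refine ⟨fun φ ψ y hφ hψ hS => ?_, fun x hx => ?_⟩
    · simp only [Pi.smul_apply, h1 φ ψ y hφ hψ hS]
      ext v
      simp [pull]
    · obtain ⟨c, hc, hxc, θ, hθ⟩ := h2 x hx
      exact ⟨c, hc, hxc, _, hθ.smul r⟩

/-- The space `Γ_ext` of extendable sections over `S ∩ X'` of the bundle `Λ^p T^* X'` of
`p`-covectors. For `S = X` these are the extendable differential `p`-forms on `X`. (Extendable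
sections are smooth, since pull-backs of smooth forms are.) -/
def ExtForms (V : AnalyticVariety n X) (𝕜 : Type) [RCLike 𝕜] (p : ℕ) (S : Set X) : Type u :=
  extSubmodule V 𝕜 p S

instance ExtForms.addCommGroup (V : AnalyticVariety n X) (p : ℕ) (S : Set X) :
    AddCommGroup (ExtForms V 𝕜 p S) :=
  inferInstanceAs (AddCommGroup (extSubmodule V 𝕜 p S))

instance ExtForms.module (V : AnalyticVariety n X) (p : ℕ) (S : Set X) :
    Module 𝕜 (ExtForms V 𝕜 p S) :=
  inferInstanceAs (Module 𝕜 (extSubmodule V 𝕜 p S))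

theorem ExtForms.ext' {V : AnalyticVariety n X} {p : ℕ} {S : Set X} {ω ω' : ExtForms V 𝕜 p S}
    (h : ∀ φ y, ω.1 φ y = ω'.1 φ y) : ω = ω' :=
  Subtype.ext (funext fun φ => funext fun y => h φ y)

section derivative

variable {V : AnalyticVariety n X} {p : ℕ} {S : Set X}

theorem contDiffAt_extDeriv {m : ℕ} {θ : (Fin m → ℂ) → Alt 𝕜 m p} {z : Fin m → ℂ}
    (h : ContDiffAt ℝ ((⊤ : ℕ∞) : WithTop ℕ∞) θ z) :
    ContDiffAt ℝ ((⊤ : ℕ∞) : WithTop ℕ∞) (extDeriv θ) z := by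
  have h1 := h.fderiv_right (m := ((⊤ : ℕ∞) : WithTop ℕ∞)) le_rfl
  exact ContDiffAt.comp z (g := ContinuousAlternatingMap.alternatizeUncurryFinCLM ℝ (Fin m → ℂ) 𝕜)
    (ContinuousLinearMap.contDiff _).contDiffAt h1

/-- The set `S` is the closure of an open set. -/
def IsClosureOfOpen (S : Set X) : Prop := ∃ U : Set X, IsOpen U ∧ S = closure U

theorem IsClosureOfOpen.subset (hS : IsClosureOfOpen S) : S ⊆ closure (interior S) := by
  obtain ⟨U, hU, rfl⟩ := hS
  exact closure_mono (interior_maximal subset_closure hU)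

theorem isClosureOfOpen_univ : IsClosureOfOpen (univ : Set X) := ⟨univ, isOpen_univ, by simp⟩

theorem ExtendsAt.extDeriv_unique (hS : IsClosureOfOpen S) {φ : V.RegularChart} {y : X}
    (hy : y ∈ φ.1.F.source) (hyS : y ∈ S) {ω : Family V 𝕜 p S}
    {θ θ' : (Fin φ.1.dim → ℂ) → Alt 𝕜 φ.1.dim p}
    (h : ExtendsAt φ.1 θ y ω) (h' : ExtendsAt φ.1 θ' y ω) :
    extDeriv θ (φ.1.F y) = extDeriv θ' (φ.1.F y) := by
  by_contra hne
  have c1 := (contDiffAt_extDeriv h.1.self_of_nhds).continuousAt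
  have c2 := (contDiffAt_extDeriv h'.1.self_of_nhds).continuousAt
  have hev : ∀ᶠ y' in 𝓝 y, extDeriv θ (φ.1.F y') ≠ extDeriv θ' (φ.1.F y') :=
    ((c1.comp (φ.1.continuousAt hy)).ne_iff_eventually_ne (c2.comp (φ.1.continuousAt hy))).1 hne
  have hEq : ∀ᶠ y' in 𝓝 y, y' ∈ φ.1.F.source ∧ (y' ∈ S → θ (φ.1.F y') = θ' (φ.1.F y')) := by
    filter_upwards [h.2, h'.2, φ.1.source_mem hy] with y' h1 h2 h3
    refine ⟨h3, fun h4 => ?_⟩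
    have e1 := h1 φ ⟨h3, h4⟩
    have e2 := h2 φ ⟨h3, h4⟩
    rw [φ.pull_self h3] at e1 e2
    rw [← e1, ← e2]
  obtain ⟨y', hint, hne', hE⟩ := ((mem_closure_iff_frequently.1 (hS.subset hyS)).and_eventually
    (hev.and (eventually_eventually_nhds.2 hEq))).exists
  apply hne'
  apply Filter.EventuallyEq.extDeriv_eq
  have hs := hE.self_of_nhds.1
  filter_upwards [φ.symm_tendsto hs (hE.and (isOpen_interior.mem_nhds hint)),
    φ.2.2.mem_nhds (φ.1.F.map_source hs)] with z hz hzt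
  have := hz.1.2 (interior_subset hz.2)
  rwa [φ.1.F.right_inv hzt] at this

open Classical in
/-- The exterior derivative of an extendable form on `S`: at a point `y` of `S ∩ X'` lying in the
holomorphic chart `φ`, it is computed from any smooth form on a neighbourhood of `φ(y)` which
extends the form on `S` around `y` (`0` if there is none). -/
def dFamily (ω : Family V 𝕜 p S) : Family V 𝕜 (p + 1) S := fun φ y =>
  if h : ∃ θ, ExtendsAt φ.1 θ y.1 ω then extDeriv h.choose (φ.1.F y.1) else 0

theorem ExtendsAt.dFamily_eq (hS : IsClosureOfOpen S) {φ : V.RegularChart} {y : X}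
    (hy : y ∈ φ.1.F.source ∧ y ∈ S) {ω : Family V 𝕜 p S}
    {θ : (Fin φ.1.dim → ℂ) → Alt 𝕜 φ.1.dim p} (h : ExtendsAt φ.1 θ y ω) :
    dFamily ω φ ⟨y, hy⟩ = extDeriv θ (φ.1.F y) := by
  have hex : ∃ θ, ExtendsAt φ.1 θ y ω := ⟨θ, h⟩
  have : dFamily ω φ ⟨y, hy⟩ = extDeriv hex.choose (φ.1.F y) := dif_pos hex
  rw [this]
  exact ExtendsAt.extDeriv_unique hS hy.1 hy.2 hex.choose_spec h

/-- If `θ` extends `ω` then `dθ` extends `dω`. -/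
theorem ExtendsAt.extDeriv (hS : IsClosureOfOpen S) {c : AnalyticChart X} (hc : c ∈ V.atlas)
    {θ : (Fin c.dim → ℂ) → Alt 𝕜 c.dim p} {x : X} {ω : Family V 𝕜 p S} (hx : x ∈ c.F.source)
    (h : ExtendsAt c θ x ω) : ExtendsAt c (extDeriv θ) x (dFamily ω) := by
  refine ⟨h.1.mono fun w hw => contDiffAt_extDeriv hw, ?_⟩
  filter_upwards [h.eventually hx, c.source_mem hx] with y hy hyc φ hφ
  have e : (c.F ∘ φ.1.F.symm) (φ.1.F y) = c.F y := by simp [φ.1.F.left_inv hφ.1]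
  have h1 := hy.transfer φ.2.1 hyc hφ.1 (φ.analyticAt hc hφ.1 hyc)
    (Eventually.of_forall fun _ => rfl)
  rw [h1.dFamily_eq hS hφ, ← e]
  refine extDeriv_pullback (r := ⊤) ?_ (φ.contDiffAt hc hφ.1 hyc) le_top
  rw [e]
  exact hy.1.self_of_nhds.differentiableAt (by simp)

theorem dFamily_mem (hS : IsClosureOfOpen S) {ω : Family V 𝕜 p S} (h : ω ∈ extSubmodule V 𝕜 p S) :
    dFamily ω ∈ extSubmodule V 𝕜 (p + 1) S := by
  refine ⟨fun φ ψ y hφ hψ hyS => ?_, fun x hx => ?_⟩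
  · obtain ⟨θ, hθ⟩ := h.2.exists_extendsAt ψ.2.1 hψ hyS
    rw [hθ.dFamily_eq hS ⟨hψ, hyS⟩]
    exact (hθ.extDeriv hS ψ.2.1 hψ).2.self_of_nhds φ ⟨hφ, hyS⟩
  · obtain ⟨c, hc, hxc, θ, hθ⟩ := h.2 x hx
    exact ⟨c, hc, hxc, _, hθ.extDeriv hS hc hxc⟩

theorem extDeriv_smul_field {m : ℕ} (r : 𝕜) {θ : (Fin m → ℂ) → Alt 𝕜 m p} {z : Fin m → ℂ}
    (h : DifferentiableAt ℝ θ z) : extDeriv (r • θ) z = r • extDeriv θ z := by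
  have : fderiv ℝ (r • θ) z = r • fderiv ℝ θ z := fderiv_const_smul h r
  simp only [_root_.extDeriv, this, ContinuousAlternatingMap.alternatizeUncurryFin_smul]

/-- The exterior differential `d^p` on extendable forms on the closure `S` of an open set. -/
def d (V : AnalyticVariety n X) (𝕜 : Type) [RCLike 𝕜] (p : ℕ) {S : Set X} (hS : IsClosureOfOpen S) : ExtForms V 𝕜 p S →ₗ[𝕜] ExtForms V 𝕜 (p + 1) S where
  toFun ω := ⟨dFamily ω.1, dFamily_mem hS ω.2⟩
  map_add' := by
    rintro ⟨ω, hω⟩ ⟨ω', hω'⟩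
    refine ExtForms.ext' fun φ ⟨y, hy⟩ => ?_
    obtain ⟨θ, hθ⟩ := hω.2.exists_extendsAt φ.2.1 hy.1 hy.2
    obtain ⟨θ', hθ'⟩ := hω'.2.exists_extendsAt φ.2.1 hy.1 hy.2
    change dFamily (ω + ω') φ ⟨y, hy⟩ = dFamily ω φ ⟨y, hy⟩ + dFamily ω' φ ⟨y, hy⟩
    rw [hθ.dFamily_eq hS hy, hθ'.dFamily_eq hS hy, (hθ.add hθ').dFamily_eq hS hy]
    exact extDeriv_add (hθ.1.self_of_nhds.differentiableAt (by simp))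
      (hθ'.1.self_of_nhds.differentiableAt (by simp))
  map_smul' := by
    rintro r ⟨ω, hω⟩
    refine ExtForms.ext' fun φ ⟨y, hy⟩ => ?_
    obtain ⟨θ, hθ⟩ := hω.2.exists_extendsAt φ.2.1 hy.1 hy.2
    change dFamily (r • ω) φ ⟨y, hy⟩ = r • dFamily ω φ ⟨y, hy⟩
    rw [hθ.dFamily_eq hS hy, (hθ.smul r).dFamily_eq hS hy]
    exact extDeriv_smul_field r (hθ.1.self_of_nhds.differentiableAt (by simp))

theorem d_d (hS : IsClosureOfOpen S) (ω : ExtForms V 𝕜 p S) :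
    d V 𝕜 (p + 1) hS (d V 𝕜 p hS ω) = 0 := by
  obtain ⟨ω, hω⟩ := ω
  refine ExtForms.ext' fun φ ⟨y, hy⟩ => ?_
  obtain ⟨θ, hθ⟩ := hω.2.exists_extendsAt φ.2.1 hy.1 hy.2
  change dFamily (dFamily ω) φ ⟨y, hy⟩ = 0
  rw [(hθ.extDeriv hS φ.2.1 hy.1).dFamily_eq hS hy]
  have hsm : minSmoothness ℝ 2 ≤ ((⊤ : ℕ∞) : WithTop ℕ∞) := by
    rw [minSmoothness_of_isRCLikeNormedField]
    exact WithTop.coe_le_coe.2 (le_top : (2 : ℕ∞) ≤ ⊤)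
  exact extDeriv_extDeriv_apply hθ.1.self_of_nhds hsm

/-- Restriction of families from `X` to `Z`. -/
def resFamily (Z : Set X) (ω : Family V 𝕜 p univ) : Family V 𝕜 p Z :=
  fun φ y => ω φ ⟨y.1, y.2.1, mem_univ y.1⟩

theorem ExtendsAt.res {Z : Set X} {c : AnalyticChart X} {θ : (Fin c.dim → ℂ) → Alt 𝕜 c.dim p}
    {x : X} {ω : Family V 𝕜 p univ} (h : ExtendsAt c θ x ω) :
    ExtendsAt c θ x (resFamily Z ω) :=
  ⟨h.1, h.2.mono fun _ hy φ hφ => hy φ ⟨hφ.1, mem_univ _⟩⟩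

/-- The restriction `ω ↦ ω|_Z` of extendable forms on `X` to `Z`. -/
def res (V : AnalyticVariety n X) (𝕜 : Type) [RCLike 𝕜] (p : ℕ) (Z : Set X) :
    ExtForms V 𝕜 p univ →ₗ[𝕜] ExtForms V 𝕜 p Z where
  toFun ω := ⟨resFamily Z ω.1, fun φ ψ y hφ hψ _ => ω.2.1 φ ψ y hφ hψ (mem_univ y),
    fun x _ => by
      obtain ⟨c, hc, hxc, θ, hθ⟩ := ω.2.2 x (mem_univ x)
      exact ⟨c, hc, hxc, θ, hθ.res⟩⟩
  map_add' _ _ := rfl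
  map_smul' _ _ := rfl

theorem res_d {Z : Set X} (hZ : IsClosureOfOpen Z) (ω : ExtForms V 𝕜 p univ) :
    res V 𝕜 (p + 1) Z (d V 𝕜 p isClosureOfOpen_univ ω) = d V 𝕜 p hZ (res V 𝕜 p Z ω) := by
  obtain ⟨ω, hω⟩ := ω
  refine ExtForms.ext' fun φ ⟨y, hy⟩ => ?_
  obtain ⟨θ, hθ⟩ := hω.2.exists_extendsAt φ.2.1 hy.1 (mem_univ y)
  change dFamily ω φ ⟨y, hy.1, mem_univ y⟩ = dFamily (resFamily Z ω) φ ⟨y, hy⟩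
  rw [hθ.dFamily_eq isClosureOfOpen_univ, hθ.res.dFamily_eq hZ]

end derivative

/-! ### Cohomology -/

section cohomology

variable {C D : ℕ → Type*} [∀ p, AddCommGroup (C p)] [∀ p, Module 𝕜 (C p)]
  [∀ p, AddCommGroup (D p)] [∀ p, Module 𝕜 (D p)]

/-- The `p`-cocycles `Z^p = ker d^p` of a complex `C⁰ → C¹ → ⋯`. -/
def cocycles (δ : ∀ p, C p →ₗ[𝕜] C (p + 1)) (p : ℕ) : Submodule 𝕜 (C p) := LinearMap.ker (δ p)

/-- The `p`-coboundaries `B^p = im d^{p-1}` of a complex `C⁰ → C¹ → ⋯`, with `B⁰ = 0`. -/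
def coboundaries (δ : ∀ p, C p →ₗ[𝕜] C (p + 1)) : (p : ℕ) → Submodule 𝕜 (C p)
  | 0 => ⊥
  | p + 1 => LinearMap.range (δ p)

/-- The cohomology `H^p = Z^p / B^p` of a complex `C⁰ → C¹ → ⋯`. -/
abbrev Cohomology (δ : ∀ p, C p →ₗ[𝕜] C (p + 1)) (p : ℕ) : Type _ :=
  cocycles δ p ⧸ (coboundaries δ p).submoduleOf (cocycles δ p)

/-- The map `[ω] ↦ [α ω]` induced in cohomology by a cochain map `α`. -/
def cohomologyMap {δ : ∀ p, C p →ₗ[𝕜] C (p + 1)} {ε : ∀ p, D p →ₗ[𝕜] D (p + 1)}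
    (α : ∀ p, C p →ₗ[𝕜] D p) (hα : ∀ p ω, α (p + 1) (δ p ω) = ε p (α p ω)) (p : ℕ) :
    Cohomology δ p →ₗ[𝕜] Cohomology ε p :=
  Submodule.mapQ _ _
    ((α p).restrict (p := cocycles δ p) (q := cocycles ε p) fun ω hω => by
      have hω' : δ p ω = 0 := hω
      change ε p (α p ω) = 0
      rw [← hα, hω', map_zero])
    (by
      rintro ⟨ω, hω⟩ h
      cases p with
      | zero =>
        have h0 : ω = 0 := h
        change α 0 ω = 0
        rw [h0, map_zero]
      | succ p =>
        obtain ⟨η, hη⟩ : ∃ η, δ p η = ω := h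
        exact ⟨α p η, by rw [← hα, hη]; rfl⟩)

end cohomology

section comparison

variable (V : AnalyticVariety n X) (𝕜 : Type) [RCLike 𝕜]

/-- Extendable `p`-forms on `X` vanishing on `Z`: those with `ω|_Z = 0`. -/
def VanishingForms (Z : Set X) (p : ℕ) : Submodule 𝕜 (ExtForms V 𝕜 p univ) :=
  LinearMap.ker (res V 𝕜 p Z)

/-- The restriction of `d` to forms vanishing on `Z`. -/
def dVanishing {Z : Set X} (hZ : IsClosureOfOpen Z) (p : ℕ) :
    VanishingForms V 𝕜 Z p →ₗ[𝕜] VanishingForms V 𝕜 Z (p + 1) :=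
  (d V 𝕜 p isClosureOfOpen_univ).restrict fun ω hω => by
    have hω' : res V 𝕜 p Z ω = 0 := hω
    change res V 𝕜 (p + 1) Z _ = 0
    rw [res_d hZ, hω', map_zero]

/-- Extendable `(p-1)`-forms on `Z`; there are no nonzero forms of degree `-1`. -/
def PrevForms (Z : Set X) : ℕ → Type u
  | 0 => PUnit
  | p + 1 => ExtForms V 𝕜 p Z

instance PrevForms.addCommGroup (Z : Set X) : ∀ p, AddCommGroup (PrevForms V 𝕜 Z p)
  | 0 => (inferInstance : AddCommGroup PUnit.{u + 1})
  | p + 1 => (inferInstance : AddCommGroup (ExtForms V 𝕜 p Z))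

instance PrevForms.module (Z : Set X) : ∀ p, Module 𝕜 (PrevForms V 𝕜 Z p)
  | 0 => (inferInstance : Module 𝕜 PUnit.{u + 1})
  | p + 1 => (inferInstance : Module 𝕜 (ExtForms V 𝕜 p Z))

/-- The differential `d^{p-1}` on extendable `(p-1)`-forms on `Z`. -/
def dPrev {Z : Set X} (hZ : IsClosureOfOpen Z) :
    ∀ p, PrevForms V 𝕜 Z p →ₗ[𝕜] ExtForms V 𝕜 p Z
  | 0 => 0
  | p + 1 => d V 𝕜 p hZ

/-- Extendable `p`-forms relative to `(X, Z)`: pairs `(κ, υ)` of an extendable `p`-form on `X` and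
an extendable `(p-1)`-form on `Z`. -/
abbrev RelativeForms (Z : Set X) (p : ℕ) : Type u := ExtForms V 𝕜 p univ × PrevForms V 𝕜 Z p

/-- The differential `(κ, υ) ↦ (dκ, κ|_Z - dυ)` of the mapping cone. -/
def dRelative {Z : Set X} (hZ : IsClosureOfOpen Z) (p : ℕ) :
    RelativeForms V 𝕜 Z p →ₗ[𝕜] RelativeForms V 𝕜 Z (p + 1) :=
  LinearMap.prod (d V 𝕜 p isClosureOfOpen_univ ∘ₗ LinearMap.fst 𝕜 _ _)
    (M₃ := PrevForms V 𝕜 Z (p + 1))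
    (res V 𝕜 p Z ∘ₗ LinearMap.fst 𝕜 _ _ - dPrev V 𝕜 hZ p ∘ₗ LinearMap.snd 𝕜 _ _)

theorem dVanishing_dVanishing {Z : Set X} (hZ : IsClosureOfOpen Z) (p : ℕ)
    (ω : VanishingForms V 𝕜 Z p) : dVanishing V 𝕜 hZ (p + 1) (dVanishing V 𝕜 hZ p ω) = 0 :=
  Subtype.ext (d_d isClosureOfOpen_univ ω.1)

theorem dRelative_dRelative {Z : Set X} (hZ : IsClosureOfOpen Z) (p : ℕ)
    (ω : RelativeForms V 𝕜 Z p) : dRelative V 𝕜 hZ (p + 1) (dRelative V 𝕜 hZ p ω) = 0 := by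
  obtain ⟨κ, υ⟩ := ω
  refine Prod.ext (d_d isClosureOfOpen_univ κ) ?_
  change res V 𝕜 (p + 1) Z (d V 𝕜 p isClosureOfOpen_univ κ)
    - d V 𝕜 p hZ (res V 𝕜 p Z κ - dPrev V 𝕜 hZ p υ) = 0
  rw [res_d hZ, map_sub]
  cases p with
  | zero => simp [dPrev]
  | succ p =>
    simp only [dPrev, sub_sub_cancel]
    exact d_d hZ υ

/-- The cohomology `H_ext^p(X)_Z` of extendable forms on `X` vanishing on `Z`. -/
abbrev VanishingCohomology {Z : Set X} (hZ : IsClosureOfOpen Z) (p : ℕ) : Type u :=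
  Cohomology (C := fun p => VanishingForms V 𝕜 Z p) (dVanishing V 𝕜 hZ) p

/-- The extendable cohomology `H_ext^p(X, Z)` relative to the pair `(X, Z)`. -/
abbrev RelativeCohomology {Z : Set X} (hZ : IsClosureOfOpen Z) (p : ℕ) : Type u :=
  Cohomology (C := fun p => RelativeForms V 𝕜 Z p) (dRelative V 𝕜 hZ) p

/-- The map `α^p : ω ↦ (ω, 0)`. -/
def relAlpha (Z : Set X) (p : ℕ) : VanishingForms V 𝕜 Z p →ₗ[𝕜] RelativeForms V 𝕜 Z p :=
  LinearMap.inl 𝕜 _ _ ∘ₗ (VanishingForms V 𝕜 Z p).subtype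

theorem relAlpha_comm {Z : Set X} (hZ : IsClosureOfOpen Z) (p : ℕ) (ω : VanishingForms V 𝕜 Z p) :
    relAlpha V 𝕜 Z (p + 1) (dVanishing V 𝕜 hZ p ω) = dRelative V 𝕜 hZ p (relAlpha V 𝕜 Z p ω) := by
  refine Prod.ext rfl ?_
  have hω : res V 𝕜 p Z ω.1 = 0 := ω.2
  change (0 : ExtForms V 𝕜 p Z) = res V 𝕜 p Z ω.1 - dPrev V 𝕜 hZ p 0
  rw [hω, map_zero, sub_zero]

/-- The homomorphism `A^p : H_ext^p(X)_Z → H_ext^p(X, Z)`, `[ω] ↦ [(ω, 0)]`. -/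
def relA {Z : Set X} (hZ : IsClosureOfOpen Z) (p : ℕ) :
    VanishingCohomology V 𝕜 hZ p →ₗ[𝕜] RelativeCohomology V 𝕜 hZ p :=
  cohomologyMap (C := fun p => VanishingForms V 𝕜 Z p) (D := fun p => RelativeForms V 𝕜 Z p)
    (relAlpha V 𝕜 Z) (relAlpha_comm V 𝕜 hZ) p

end comparison

end ExtForm

end

/-! The heart of the matter is that every extendable form on the closed set `Z` is the restriction
of an extendable form on `X` (`res_surjective`). Hence `0 → Γ(X)_Z → Γ(X) → Γ(Z) → 0` is exact, and
the kernel of a surjective cochain map has the cohomology of its mapping cone. Concretely, lift the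
second component `υ` of a cone element `(κ, υ)` to a form `σ` on `X`; subtracting the differential
`(dσ, υ)` of `(σ, 0)` leaves `(κ - dσ, 0)`. This single correction gives both `relA_injective` and
`relA_surjective`.

Surjectivity of restriction is a partition of unity argument. Near a point of `Z` the form comes
from a smooth form on the number space of a chart, whose pull-back is defined at all nearby regular
points of `X`, not only those in `Z`; away from `Z` the zero form serves. Cut off by a bump function
`f`, the pull-back becomes a global form restricting to `f • ω` (`exists_bump_extension`). Chart
targets are locally compact, being locally zero sets of holomorphic functions, so `X` admits a
locally finite cover by supports of such functions. The sum of the cut-off forms, divided by the sum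
of the bump functions, restricts to `ω`. -/

namespace ExtForm

universe u

variable {n : ℕ} {X : Type u} [TopologicalSpace X] {𝕜 : Type} [RCLike 𝕜]

/-! ### Topology of analytic varieties -/

/-- Small balls around a point of the target meet the target in a compact set. -/
theorem AnalyticChart.exists_isCompact (c : AnalyticChart X) {z : Fin c.dim → ℂ}
    (hz : z ∈ c.F.target) :
    ∃ r > 0, IsCompact (Metric.closedBall z r ∩ c.F.target) := by
  -- The target is closed only relative to `U`, so the ball is chosen inside `U`. A limit point of
  -- the target in the ball then has a local defining function `f`, and `f w ≠ 0` would keep the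
  -- target away from `w`.
  obtain ⟨r, hr, hrU⟩ := Metric.nhds_basis_closedBall.mem_iff.1
    (c.isOpen_U.mem_nhds (c.target_subset hz))
  refine ⟨r, hr, (isCompact_closedBall z r).of_isClosed_subset ?_ inter_subset_left⟩
  refine isClosed_of_closure_subset fun w hw => ?_
  have hwb : w ∈ Metric.closedBall z r :=
    Metric.isClosed_closedBall.closure_subset_iff.2 inter_subset_left hw
  refine ⟨hwb, ?_⟩
  obtain ⟨k, f, hf, he⟩ := c.analytic w (hrU hwb)
  by_contra hwt
  have hne : f w ≠ 0 := fun h => hwt (he.self_of_nhds.2 h)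
  obtain ⟨v, ⟨-, hv⟩, hv', hv''⟩ := ((mem_closure_iff_frequently.1 hw).and_eventually
    (he.and (hf.continuousAt.eventually_ne hne))).exists
  exact hv'' (hv'.1 hv)

/-- Preimages of small balls around `F x` form a neighbourhood basis at `x`. -/
theorem AnalyticChart.exists_ball_subset (c : AnalyticChart X) {x : X} (hx : x ∈ c.F.source)
    {N : Set X} (hN : N ∈ 𝓝 x) :
    ∃ r > 0, ∀ w ∈ Metric.closedBall (c.F x) r ∩ c.F.target, c.F.symm w ∈ N := by
  have h : Tendsto c.F.symm (𝓝[c.F.target] (c.F x)) (𝓝 x) := by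
    have := c.continuousOn_invFun (c.F x) (c.F.map_source hx)
    rwa [ContinuousWithinAt, c.F.left_inv hx] at this
  obtain ⟨r, hr, h⟩ := (nhdsWithin_hasBasis Metric.nhds_basis_closedBall _).mem_iff.1 (h hN)
  exact ⟨r, hr, h⟩

theorem AnalyticChart.isCompact_image_symm (c : AnalyticChart X) {K : Set (Fin c.dim → ℂ)}
    (hK : IsCompact (K ∩ c.F.target)) : IsCompact (c.F.symm '' (K ∩ c.F.target)) :=
  hK.image_of_continuousOn (c.continuousOn_invFun.mono inter_subset_right)

theorem AnalyticChart.mem_image_symm (c : AnalyticChart X) {K : Set (Fin c.dim → ℂ)} {y : X}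
    (hy : y ∈ c.F.source) (h : c.F y ∈ K) : y ∈ c.F.symm '' (K ∩ c.F.target) :=
  ⟨c.F y, ⟨h, c.F.map_source hy⟩, c.F.left_inv hy⟩

/-- The inverse chart carries the compact piece of the target in a small ball to a compact
neighbourhood. Together with second countability this provides the locally finite covers used to
glue forms. -/
theorem AnalyticVariety.weaklyLocallyCompactSpace (V : AnalyticVariety n X) :
    WeaklyLocallyCompactSpace X := by
  refine ⟨fun x => ?_⟩
  obtain ⟨c, -, hx⟩ := V.covers x
  obtain ⟨r, hr, hK⟩ := c.exists_isCompact (c.F.map_source hx)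
  refine ⟨_, c.isCompact_image_symm hK, ?_⟩
  filter_upwards [c.source_mem hx, c.continuousAt hx (Metric.closedBall_mem_nhds _ hr)]
    with y hy hy' using c.mem_image_symm hy hy'

/-! ### Smooth functions on analytic varieties -/

/-- A real function on `X` is smooth if in each chart it is locally the restriction of a smooth
function of the number space. -/
def IsSmoothFunction (V : AnalyticVariety n X) (f : X → ℝ) : Prop :=
  ∀ x, ∀ c ∈ V.atlas, x ∈ c.F.source → ∃ g : (Fin c.dim → ℂ) → ℝ,
    (∀ᶠ w in 𝓝 (c.F x), ContDiffAt ℝ ((⊤ : ℕ∞) : WithTop ℕ∞) g w) ∧ ∀ᶠ y in 𝓝 x, f y = g (c.F y)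

section smoothFunctions

variable {V : AnalyticVariety n X}

/-- Smoothness around a point need only be checked in one chart. -/
theorem exists_smooth_transfer {c c' : AnalyticChart X} (hc : c ∈ V.atlas) (hc' : c' ∈ V.atlas)
    {x : X} (hx : x ∈ c.F.source) (hx' : x ∈ c'.F.source) {f : X → ℝ} {g : (Fin c.dim → ℂ) → ℝ}
    (hg : ∀ᶠ w in 𝓝 (c.F x), ContDiffAt ℝ ((⊤ : ℕ∞) : WithTop ℕ∞) g w)
    (hfg : ∀ᶠ y in 𝓝 x, f y = g (c.F y)) :
    ∃ g' : (Fin c'.dim → ℂ) → ℝ,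
      (∀ᶠ w in 𝓝 (c'.F x), ContDiffAt ℝ ((⊤ : ℕ∞) : WithTop ℕ∞) g' w) ∧
        ∀ᶠ y in 𝓝 x, f y = g' (c'.F y) := by
  obtain ⟨G, hG, hGe⟩ := V.compatible c' hc' c hc (c'.F x)
    ⟨c'.F.map_source hx', by simpa [c'.F.left_inv hx'] using hx⟩
  have hGe' : ∀ᶠ y in 𝓝 x, c.F y = G (c'.F y) := by
    have h1 := (c'.continuousAt hx').eventually (eventually_nhdsWithin_iff.1 hGe)
    filter_upwards [h1, c.source_mem hx, c'.source_mem hx'] with y h1 h2 h3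
    have := h1 ⟨c'.F.map_source h3, by simpa [c'.F.left_inv h3] using h2⟩
    simpa [c'.F.left_inv h3] using this
  refine ⟨g ∘ G, ?_, ?_⟩
  · rw [hGe'.self_of_nhds] at hg
    filter_upwards [hG.continuousAt.eventually hg, hG.eventually_analyticAt] with w h1 h2
    exact h1.comp w (h2.restrictScalars (𝕜 := ℝ)).contDiffAt
  · filter_upwards [hfg, hGe'] with y h1 h2
    rw [h1, h2]; rfl

theorem IsSmoothFunction.of_eventuallyEq {f : X → ℝ}
    (h : ∀ x, ∃ f', IsSmoothFunction V f' ∧ f =ᶠ[𝓝 x] f') : IsSmoothFunction V f := by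
  intro x c hc hx
  obtain ⟨f', hf', he⟩ := h x
  obtain ⟨g, hg, hfg⟩ := hf' x c hc hx
  exact ⟨g, hg, by filter_upwards [he, hfg] with y h1 h2 using h1.trans h2⟩

theorem IsSmoothFunction.sum {ι : Type*} {f : ι → X → ℝ} (h : ∀ i, IsSmoothFunction V (f i))
    (I : Finset ι) : IsSmoothFunction V fun y => ∑ i ∈ I, f i y := by
  intro x c hc hx
  choose g hg hfg using fun i => h i x c hc hx
  refine ⟨fun w => ∑ i ∈ I, g i w, ?_, ?_⟩
  · filter_upwards [(eventually_all_finset I).2 fun i _ => hg i] with w hw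
    exact ContDiffAt.sum hw
  · filter_upwards [(eventually_all_finset I).2 fun i _ => hfg i] with y hy
    exact Finset.sum_congr rfl hy

theorem IsSmoothFunction.finsum {ι : Type*} {f : ι → X → ℝ} (h : ∀ i, IsSmoothFunction V (f i))
    (hf : LocallyFinite fun i => Function.support (f i)) :
    IsSmoothFunction V fun y => ∑ᶠ i, f i y := by
  refine .of_eventuallyEq fun x => ?_
  obtain ⟨U, hU, hfin⟩ := hf x
  refine ⟨_, .sum h hfin.toFinset, ?_⟩
  filter_upwards [hU] with y hyU
  refine finsum_eq_sum_of_support_subset _ fun i hi => ?_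
  rw [Finite.coe_toFinset]
  exact ⟨y, hi, hyU⟩

theorem IsSmoothFunction.inv {f : X → ℝ} (h : IsSmoothFunction V f) (h0 : ∀ y, f y ≠ 0) :
    IsSmoothFunction V fun y => (f y)⁻¹ := by
  intro x c hc hx
  obtain ⟨g, hg, hfg⟩ := h x c hc hx
  have hg0 : g (c.F x) ≠ 0 := hfg.self_of_nhds ▸ h0 x
  refine ⟨fun w => (g w)⁻¹, ?_, hfg.mono fun y hy => congrArg _ hy⟩
  filter_upwards [hg, hg.self_of_nhds.continuousAt.eventually_ne hg0] with w h1 h2 using h1.inv h2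

/-- Smooth bump functions supported in a given neighbourhood of a point. -/
theorem AnalyticVariety.exists_bump [T2Space X] (V : AnalyticVariety n X) {x : X} {N : Set X}
    (hN : N ∈ 𝓝 x) :
    ∃ f : X → ℝ, IsSmoothFunction V f ∧ (∀ y, 0 ≤ f y) ∧ 0 < f x ∧ tsupport f ⊆ N := by
  obtain ⟨c, hc, hx⟩ := V.covers x
  obtain ⟨r, hr, hK⟩ := c.exists_isCompact (c.F.map_source hx)
  obtain ⟨s, hs, hsN⟩ := c.exists_ball_subset hx hN
  have hK' : IsCompact (Metric.closedBall (c.F x) (min r s) ∩ c.F.target) := by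
    have := hK.inter_left (Metric.isClosed_closedBall (x := c.F x) (ε := min r s))
    rwa [← inter_assoc, inter_eq_self_of_subset_left
      (Metric.closedBall_subset_closedBall (min_le_left r s))] at this
  have hmin : 0 < min r s := lt_min hr hs
  -- Compactness makes this set closed in all of the Hausdorff space `X`, not merely in the source
  -- of `c`; this keeps the closed support of the bump inside the chart and makes extension by zero
  -- smooth.
  have hclosed := (c.isCompact_image_symm hK').isClosed
  obtain ⟨b, hb, hb0, hbx, hbs⟩ : ∃ b : (Fin c.dim → ℂ) → ℝ,
      ContDiff ℝ ((⊤ : ℕ∞) : WithTop ℕ∞) b ∧ (∀ w, 0 ≤ b w) ∧ 0 < b (c.F x) ∧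
        Function.support b ⊆ Metric.closedBall (c.F x) (min r s) := by
    obtain ⟨b, h1, -, h3, h4, h5⟩ := exists_contDiff_tsupport_subset (n := (⊤ : ℕ∞))
      (Metric.closedBall_mem_nhds (c.F x) hmin)
    exact ⟨b, h3, fun w => (h4 ⟨w, rfl⟩).1, by rw [h5]; exact one_pos,
      (subset_tsupport b).trans h1⟩
  let f : X → ℝ := c.F.source.indicator (b ∘ c.F)
  have hsupp : tsupport f ⊆ c.F.symm '' (Metric.closedBall (c.F x) (min r s) ∩ c.F.target) := by
    refine closure_minimal (fun y hy => ?_) hclosed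
    have hys : y ∈ c.F.source := mem_of_indicator_ne_zero hy
    refine c.mem_image_symm hys (hbs ?_)
    rwa [Function.mem_support, show f y = b (c.F y) from indicator_of_mem hys _] at hy
  refine ⟨f, fun y c' hc' hy' => ?_, fun y => indicator_nonneg (fun _ _ => hb0 _) y, ?_, ?_⟩
  · by_cases hy : y ∈ c.F.source
    · refine exists_smooth_transfer hc hc' hy hy' (g := b)
        (Eventually.of_forall fun w => hb.contDiffAt) ?_
      filter_upwards [c.source_mem hy] with y' hy' using indicator_of_mem hy' _
    -- A point outside the source of `c` is off the closed support of `f`, so `f` vanishes near it.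
    · refine ⟨0, Eventually.of_forall fun w => contDiffAt_const, ?_⟩
      refine notMem_tsupport_iff_eventuallyEq.1 fun h => hy ?_
      obtain ⟨w, hw, rfl⟩ := hsupp h
      exact c.F.map_target hw.2
  · simpa [f, indicator_of_mem hx] using hbx
  · refine hsupp.trans ?_
    rintro _ ⟨w, hw, rfl⟩
    exact hsN w ⟨Metric.closedBall_subset_closedBall (min_le_right r s) hw.1, hw.2⟩

end smoothFunctions

/-! ### Extension of forms from a closed subset -/

section extension

variable {V : AnalyticVariety n X} {p : ℕ} {S : Set X}

theorem pull_real_smul {m k : ℕ} (f : (Fin m → ℂ) → (Fin k → ℂ)) (z : Fin m → ℂ) (r : ℝ)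
    (α : Alt 𝕜 k p) : pull f z (r • α) = r • pull f z α := rfl

theorem ExtendsAt.congr {c : AnalyticChart X} {θ : (Fin c.dim → ℂ) → Alt 𝕜 c.dim p} {x : X}
    {ω ω' : Family V 𝕜 p S} (h : ExtendsAt c θ x ω) (he : ∀ᶠ y in 𝓝 x, ∀ φ hy,
      ω' φ ⟨y, hy⟩ = ω φ ⟨y, hy⟩) : ExtendsAt c θ x ω' :=
  ⟨h.1, by filter_upwards [h.2, he] with y h1 h2 φ hy using (h2 φ hy).trans (h1 φ hy)⟩

/-- Being an extendable section is a local property. -/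
theorem extSubmodule_of_eventuallyEq {ω : Family V 𝕜 p S}
    (h : ∀ x, ∃ ω' ∈ extSubmodule V 𝕜 p S, ∀ᶠ y in 𝓝 x, ∀ φ hy, ω φ ⟨y, hy⟩ = ω' φ ⟨y, hy⟩) :
    ω ∈ extSubmodule V 𝕜 p S := by
  refine ⟨fun φ ψ y hφ hψ hS => ?_, fun x hx => ?_⟩
  · obtain ⟨ω', hω', he⟩ := h y
    rw [he.self_of_nhds, he.self_of_nhds]
    exact hω'.1 φ ψ y hφ hψ hS
  · obtain ⟨ω', hω', he⟩ := h x
    obtain ⟨c, hc, hxc, θ, hθ⟩ := hω'.2 x hx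
    exact ⟨c, hc, hxc, θ, hθ.congr he⟩

theorem ExtendsAt.smul_function {c : AnalyticChart X} {θ : (Fin c.dim → ℂ) → Alt 𝕜 c.dim p} {x : X}
    {ω : Family V 𝕜 p S} (h : ExtendsAt c θ x ω) (hc : c ∈ V.atlas) (hx : x ∈ c.F.source)
    {f : X → ℝ} (hf : IsSmoothFunction V f) :
    ∃ θ', ExtendsAt c θ' x (fun φ y => f y.1 • ω φ y : Family V 𝕜 p S) := by
  obtain ⟨g, hg, hfg⟩ := hf x c hc hx
  refine ⟨fun w => g w • θ w, ?_, ?_⟩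
  · filter_upwards [hg, h.1] with w h1 h2 using h1.smul h2
  · filter_upwards [hfg, h.2] with y h1 h2 φ hy
    rw [h1, h2 φ hy, pull_real_smul]

theorem smul_function_mem {ω : Family V 𝕜 p S} (hω : ω ∈ extSubmodule V 𝕜 p S)
    {f : X → ℝ} (hf : IsSmoothFunction V f) :
    (fun φ y => f y.1 • ω φ y : Family V 𝕜 p S) ∈ extSubmodule V 𝕜 p S := by
  refine ⟨fun φ ψ y hφ hψ hS => ?_, fun x hx => ?_⟩
  · simp only [pull_real_smul, hω.1 φ ψ y hφ hψ hS]
  · obtain ⟨c, hc, hxc, θ, hθ⟩ := hω.2 x hx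
    exact ⟨c, hc, hxc, hθ.smul_function hc hxc hf⟩

/-- Membership is local, and near each point only finitely many `s i` are met, so the sum agrees
there with a finite one. -/
theorem finsum_mem_extSubmodule {ι : Type*} {ω : ι → Family V 𝕜 p S}
    (hω : ∀ i, ω i ∈ extSubmodule V 𝕜 p S) {s : ι → Set X} (hs : LocallyFinite s)
    (h0 : ∀ i φ y, y.1 ∉ s i → ω i φ y = 0) :
    (fun φ y => ∑ᶠ i, ω i φ y : Family V 𝕜 p S) ∈ extSubmodule V 𝕜 p S := by
  refine extSubmodule_of_eventuallyEq fun x => ?_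
  obtain ⟨U, hU, hfin⟩ := hs x
  refine ⟨∑ i ∈ hfin.toFinset, ω i, sum_mem fun i _ => hω i, ?_⟩
  filter_upwards [hU] with y hyU φ hy
  rw [Finset.sum_apply, Finset.sum_apply]
  refine finsum_eq_sum_of_support_subset _ fun i hi => ?_
  rw [Finite.coe_toFinset]
  by_contra hn
  exact hi (h0 i φ _ fun hys => hn ⟨y, hys, hyU⟩)

/-- An extendable form on a closed set, multiplied with a suitable bump function, extends to `X`. -/
theorem exists_bump_extension [T2Space X] {Z : Set X} (hZ : IsClosed Z) {ω : Family V 𝕜 p Z}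
    (hω : ω ∈ extSubmodule V 𝕜 p Z) {x : X} {N : Set X} (hN : N ∈ 𝓝 x) :
    ∃ f : X → ℝ, (IsSmoothFunction V f ∧ (∀ y, 0 ≤ f y) ∧ 0 < f x ∧
      ∃ η ∈ extSubmodule V 𝕜 p univ, (∀ φ y, f y.1 = 0 → η φ y = 0) ∧
        ∀ φ y, resFamily Z η φ y = f y.1 • ω φ y) ∧ Function.support f ⊆ N := by
  obtain ⟨c, hc, hxc, θ, hθ⟩ : ∃ c ∈ V.atlas, x ∈ c.F.source ∧ ∃ θ, ExtendsAt c θ x ω := by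
    by_cases hx : x ∈ Z
    · exact hω.2 x hx
    -- Near a point off the closed set `Z` there is nothing to extend, so the zero form works
    -- vacuously.
    · obtain ⟨c, hc, hxc⟩ := V.covers x
      refine ⟨c, hc, hxc, 0, Eventually.of_forall fun w => contDiffAt_const, ?_⟩
      filter_upwards [hZ.isOpen_compl.mem_nhds hx] with y hy φ hφ using absurd hφ.2 hy
  -- The same `θ` extends `ω` around all points near `x`; the closed support of `f` is placed among
  -- these points.
  have hev := (hθ.eventually hxc).and (c.source_mem hxc)
  obtain ⟨f, hf, hf0, hfx, hfs⟩ := V.exists_bump (inter_mem hN hev)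
  refine ⟨f, ⟨hf, hf0, hfx, ?_⟩, (subset_tsupport f).trans (hfs.trans inter_subset_left)⟩
  -- The pull-back of `θ` along `c`. Its values outside the source of `c` are meaningless, but `f`
  -- vanishes there.
  let κ : Family V 𝕜 p univ := fun φ y => pull (c.F ∘ φ.1.F.symm) (φ.1.F y.1) (θ (c.F y.1))
  have hfs' : ∀ y, f y ≠ 0 → ExtendsAt c θ y ω ∧ y ∈ c.F.source :=
    fun y hy => (hfs (subset_tsupport f hy)).2
  refine ⟨fun φ y => f y.1 • κ φ y, ⟨fun φ ψ y hφ hψ hS => ?_, fun y _ => ?_⟩,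
    fun φ y hy => (congrArg (· • κ φ y) hy).trans (zero_smul ℝ (κ φ y)), fun φ y => ?_⟩
  · by_cases hy : f y = 0
    · simp only [hy, pull_real_smul]
      exact (zero_smul ℝ (κ φ _)).trans (zero_smul ℝ (pull _ _ (κ ψ _))).symm
    · obtain ⟨-, hyc⟩ := hfs' y hy
      simp only [pull_real_smul, κ]
      have e : (ψ.1.F ∘ φ.1.F.symm) (φ.1.F y) = ψ.1.F y := by simp [φ.1.F.left_inv hφ]
      -- Where `f` does not vanish, the section property is the chain rule: `c ∘ ψ⁻¹` after `ψ ∘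
      -- φ⁻¹` agrees with `c ∘ φ⁻¹` near `φ y`.
      have key := pull_pull (𝕜 := 𝕜) (p := p) (f := ψ.1.F ∘ φ.1.F.symm)
        (g := c.F ∘ ψ.1.F.symm) (z := φ.1.F y)
        (by rw [e]; exact (ψ.contDiffAt hc hψ hyc).differentiableAt (by simp))
        ((φ.contDiffAt ψ.2.1 hφ hψ).differentiableAt (by simp)) (θ (c.F y))
      rw [e] at key
      rw [key]
      congr 1
      refine pull_congr ?_ _
      filter_upwards [φ.symm_tendsto hφ (ψ.1.source_mem hψ)] with w hw
      simp [ψ.1.F.left_inv hw]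
  -- On the closed support the chart `c` works, since `θ` is smooth around `c y`; off it the family
  -- vanishes nearby and any chart does.
  · by_cases hy : y ∈ tsupport f
    · obtain ⟨-, hyθ, hyc⟩ := hfs hy
      have hκ : ExtendsAt c θ y κ := ⟨hyθ.1, Eventually.of_forall fun _ _ _ => rfl⟩
      exact ⟨c, hc, hyc, hκ.smul_function hc hyc hf⟩
    · obtain ⟨c', hc', hyc'⟩ := V.covers y
      refine ⟨c', hc', hyc', 0, Eventually.of_forall fun w => contDiffAt_const, ?_⟩
      filter_upwards [notMem_tsupport_iff_eventuallyEq.1 hy] with y' hy' φ hφ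
      simp only [hy', Pi.zero_apply]
      exact (zero_smul ℝ (κ φ _)).trans (by ext v; simp [pull])
  · change f y.1 • κ φ _ = _
    by_cases hy : f y.1 = 0
    · rw [hy]
      exact (zero_smul ℝ (κ φ _)).trans (zero_smul ℝ (ω φ y)).symm
    · rw [(hfs' _ hy).1.2.self_of_nhds φ y.2]

/-- Extendable forms on a closed subset extend to `X`. -/
theorem res_surjective [T2Space X] [SecondCountableTopology X] (V : AnalyticVariety n X)
    {Z : Set X} (hZ : IsClosed Z) : Function.Surjective (res V 𝕜 p Z) := by
  rintro ⟨ω, hω⟩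
  have := V.weaklyLocallyCompactSpace
  -- Bundling the extension of `f • ω` into the basis predicate lets the refinement theorem deliver
  -- the locally finite cover and the local extensions together.
  have hB : ∀ x : X, (𝓝 x).HasBasis (fun f : X → ℝ => IsSmoothFunction V f ∧ (∀ y, 0 ≤ f y) ∧
      0 < f x ∧ ∃ η ∈ extSubmodule V 𝕜 p univ, (∀ φ y, f y.1 = 0 → η φ y = 0) ∧
        ∀ φ y, resFamily Z η φ y = f y.1 • ω φ y) fun f => Function.support f := by
    refine fun x => ⟨fun t => ⟨fun ht => exists_bump_extension hZ hω ht, ?_⟩⟩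
    -- Conversely, the support of `f` is a neighbourhood of `x`: near `x`, `f` is a continuous
    -- function of the chart, and it is positive at `x`.
    rintro ⟨f, ⟨hf, -, hfx, -⟩, hft⟩
    obtain ⟨c, hc, hx⟩ := V.covers x
    obtain ⟨g, hg, hfg⟩ := hf x c hc hx
    have hg0 : g (c.F x) ≠ 0 := hfg.self_of_nhds ▸ hfx.ne'
    filter_upwards [hfg, c.continuousAt hx (hg.self_of_nhds.continuousAt.eventually_ne hg0)]
      with y h1 h2
    exact hft (by rw [Function.mem_support, h1]; exact h2)
  obtain ⟨ι, x, f, hf, hcov, hfin⟩ := refinement_of_locallyCompact_sigmaCompact_of_nhds_basis hB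
  choose hsm hf0 _ η hη hη0 hηω using hf
  -- All terms are nonnegative and some term is positive by the covering property. Finiteness of the
  -- support matters because `∑ᶠ` is `0` otherwise.
  have hpos : ∀ y, ∑ᶠ i, f i y ≠ 0 := by
    intro y
    obtain ⟨i, hi⟩ := mem_iUnion.1 (hcov.symm ▸ mem_univ y : y ∈ ⋃ i, Function.support (f i))
    have hfy : (Function.support fun i => f i y).Finite := hfin.point_finite y
    exact ((lt_of_le_of_ne (hf0 i y) (Ne.symm hi)).trans_le
      (single_le_finsum i hfy fun j => hf0 j y)).ne'
  -- The extension is `(∑ f i)⁻¹ • ∑ η i`; on `Z` each `η i` is `f i • ω`, and the factor `∑ f i`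
  -- cancels.
  have hmem := smul_function_mem
    (finsum_mem_extSubmodule hη hfin fun i φ y hy => hη0 i φ y (Function.notMem_support.1 hy))
    ((IsSmoothFunction.finsum hsm hfin).inv hpos)
  refine ⟨⟨_, hmem⟩, ExtForms.ext' fun φ y => ?_⟩
  change (∑ᶠ i, f i y.1)⁻¹ • ∑ᶠ i, resFamily Z (η i) φ y = ω φ y
  have hfy : (Function.support fun i => f i y.1).Finite := hfin.point_finite y.1
  simp only [hηω]
  rw [← finsum_smul' hfy, inv_smul_smul₀ (hpos _)]

end extension

/-! ### Comparison of the two cohomologies -/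

section comparison

variable {V : AnalyticVariety n X} {Z : Set X}

/-- If `(ω, 0)` is the differential of `(κ, υ)`, then `dκ = ω` and `κ|_Z = dυ`. For a lift `σ` of
`υ`, the form `κ - dσ` vanishes on `Z` and is still a primitive of `ω`. -/
theorem relA_injective (hZ : IsClosureOfOpen Z) (hres : ∀ k, Function.Surjective (res V 𝕜 k Z))
    (p : ℕ) : Function.Injective (relA V 𝕜 hZ p) := by
  rw [injective_iff_map_eq_zero]
  intro a ha
  obtain ⟨⟨⟨ω, hωZ⟩, hω⟩, rfl⟩ := Submodule.Quotient.mk_surjective _ a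
  replace ha := (Submodule.Quotient.mk_eq_zero _).1 ha
  refine (Submodule.Quotient.mk_eq_zero _).2 ?_
  match p with
  | 0 =>
    have h : ((ω, 0) : RelativeForms V 𝕜 Z 0) = 0 := ha
    exact Subtype.ext (congrArg Prod.fst h)
  | p + 1 =>
    obtain ⟨⟨κ, υ⟩, h⟩ : ∃ τ, dRelative V 𝕜 hZ p τ = (ω, 0) := ha
    have h1 : d V 𝕜 p isClosureOfOpen_univ κ = ω := congrArg Prod.fst h
    have h2 : res V 𝕜 p Z κ - dPrev V 𝕜 hZ p υ = 0 := congrArg Prod.snd h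
    suffices ∃ τ : ExtForms V 𝕜 p univ, res V 𝕜 p Z τ = 0 ∧
        d V 𝕜 p isClosureOfOpen_univ τ = ω by
      obtain ⟨τ, hτ, hτω⟩ := this
      exact ⟨⟨τ, hτ⟩, Subtype.ext hτω⟩
    match p with
    -- Here `ω` has degree 1 and `υ` degree `-1`, so `κ` already vanishes on `Z` and needs no
    -- correction.
    | 0 => exact ⟨κ, by simpa [dPrev] using h2, h1⟩
    | p + 1 =>
      obtain ⟨σ, hσ⟩ := hres p υ
      refine ⟨κ - d V 𝕜 p isClosureOfOpen_univ σ, ?_, ?_⟩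
      · rw [map_sub, res_d hZ, hσ]; exact h2
      · rw [map_sub, d_d, sub_zero, h1]

/-- For a cone cocycle, `dκ = 0` and `κ|_Z = dυ`. With a lift `σ` of `υ`, the closed form `κ - dσ`
vanishes on `Z` and represents the same class. -/
theorem relA_surjective (hZ : IsClosureOfOpen Z) (hres : ∀ k, Function.Surjective (res V 𝕜 k Z))
    (p : ℕ) : Function.Surjective (relA V 𝕜 hZ p) := by
  intro a
  obtain ⟨⟨⟨κ, υ⟩, hτ⟩, rfl⟩ := Submodule.Quotient.mk_surjective _ a
  have hτ' : dRelative V 𝕜 hZ p (κ, υ) = 0 := hτ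
  have h1 : d V 𝕜 p isClosureOfOpen_univ κ = 0 := congrArg Prod.fst hτ'
  have h2 : res V 𝕜 p Z κ - dPrev V 𝕜 hZ p υ = 0 := congrArg Prod.snd hτ'
  suffices ∃ ω : ExtForms V 𝕜 p univ, res V 𝕜 p Z ω = 0 ∧ d V 𝕜 p isClosureOfOpen_univ ω = 0 ∧
      ((ω, 0) - (κ, υ) : RelativeForms V 𝕜 Z p) ∈
        coboundaries (C := fun p => RelativeForms V 𝕜 Z p) (dRelative V 𝕜 hZ) p by
    obtain ⟨ω, hωZ, hω, h⟩ := this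
    exact ⟨Submodule.Quotient.mk ⟨⟨ω, hωZ⟩, Subtype.ext hω⟩, (Submodule.Quotient.eq _).2 h⟩
  match p with
  | 0 =>
    refine ⟨κ, by simpa [dPrev] using h2, h1, ?_⟩
    exact Prod.ext (sub_self κ) rfl
  | p + 1 =>
    obtain ⟨σ, hσ⟩ := hres p υ
    refine ⟨κ - d V 𝕜 p isClosureOfOpen_univ σ, ?_, ?_, ?_⟩
    · rw [map_sub, res_d hZ, hσ]; exact h2
    · rw [map_sub, d_d, sub_zero, h1]
    -- The difference `(κ - dσ, 0) - (κ, υ) = (-dσ, -υ)` is the cone differential of `(-σ, 0)`,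
    -- because `σ|_Z = υ`.
    · refine ⟨(-σ, 0), Prod.ext ?_ ?_⟩
      · change d V 𝕜 p isClosureOfOpen_univ (-σ) = κ - d V 𝕜 p isClosureOfOpen_univ σ - κ
        rw [map_neg]; abel
      · refine Eq.trans ?_ (zero_sub υ).symm
        change res V 𝕜 p Z (-σ) - dPrev V 𝕜 hZ p 0 = _
        rw [map_neg, hσ, map_zero, sub_zero]
        rfl

end comparison

end ExtForm

theorem mainTheorem8 {𝕜 : Type} [RCLike 𝕜] {n : ℕ} {X : Type*} [TopologicalSpace X] [T2Space X]
    [SecondCountableTopology X] (V : ExtForm.AnalyticVariety n X) (Z : Set X)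
    (hZ : ExtForm.IsClosureOfOpen Z) (p : ℕ) :
    Function.Bijective (ExtForm.relA V 𝕜 hZ p) := by
  have hclosed : IsClosed Z := by
    obtain ⟨U, -, rfl⟩ := hZ
    exact isClosed_closure
  exact ⟨ExtForm.relA_injective hZ (fun _ => ExtForm.res_surjective V hclosed) p,
    ExtForm.relA_surjective hZ (fun _ => ExtForm.res_surjective V hclosed) p⟩
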